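/- For $x\in\mathbb{R}^n$ write $\langle x\rangle=(1+|x|^2)^{1/2}$. For $m=(m_e,m_\psi)\in\mathbb{R}^2$ let $SG^m$ be the set of all $a\in C^\infty(\mathbb{R}^n\times\mathbb{R}^n;\mathbb{C})$ such that for all multi-indices $\alpha,\beta$ there is a constant $C_{\alpha\beta}$ with $$|\partial_x^\alpha\partial_\xi^\beta a(x,\xi)|\le C_{\alpha\beta}\langle x\rangle^{m_e-|\alpha|}\langle\xi\rangle^{m_\psi-|\beta|}\qquad(x,\xi\in\mathbb{R}^n).$$ An $SG$-pseudo-differential operator is a linear operator $\mathcal S(\mathbb{R}^n)\to\mathcal S(\mathbb{R}^n)$ of the form $$\mathrm{Op}(a)u(x)=(2\pi)^{-n}\int\!\!\int e^{i(x-y)\cdot\xi}a(x,\xi)u(y)\,dy\,d\xi$$ with $a\in SG^m$ for some $m\in\mathbb{R}^2$ (the integral in $y$ is taken first). Let $\mathcal RG$ be the set of those operators with $a\in\bigcap_{m}SG^m=\mathcal S(\mathbb{R}^{2n})$, and let $LG$ be the set of those with $a$ a classical $SG$-symbol of some order $m\in\mathbb{Z}^2$. Classical symbols are defined as follows. Put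 a bracket around $m_\psi$ (resp. $m_e$) to denote the symbols in $SG^{m}$ for which there is $c>0$ with $a(x,\mu\xi)=\mu^{m_\psi}a(x,\xi)$ for $\mu\ge1$, $|\xi|>c$ and all $x$ (resp. $a(\lambda x,\xi)=\lambda^{m_e}a(x,\xi)$ for $\lambda\ge1$, $|x|>c$ and all $\xi$); $SG^{[m_e],[m_\psi]}$ consists of the $a\in SG^m$ with $a(\lambda x,\mu\xi)=\lambda^{m_e}\mu^{m_\psi}a(x,\xi)$ for $\lambda,\mu\ge1$, $|x|,|\xi|>c$. A symbol $a\in SG^{m_e,m_\psi}$ (resp. $a\in SG^{[m_e],m_\psi}$) belongs to the subclass with index $cl(\psi)$ if there are $a_k\in SG^{m_e,[m_\psi-k]}$ (resp. $a_k\in SG^{[m_e],[m_\psi-k]}$), $k\ge0$, with $a-\sum_{k=0}^Na_k\in SG^{m_e,m_\psi-N-1}$ for all $N\geq 0$; the subclass with index $cl(e)$ is defined in the same way with the roles of $x$ and $\xi$ exchanged. Finally $a\in SG^m$ is classical if there are $a^\psi_k\in SG^{m_e,[m_\psi-k]}_{cl(e)}$ and $a^e_k\in SG^{[m_e-k],m_\psi}_{cl(\psi)}$,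 $k\ge0$, such that for all $N\ge0$ $$a-\sum_{k=0}^Na^\psi_k\in SG^{m_e,m_\psi-N-1}_{cl(e)},\qquad a-\sum_{k=0}^Na^e_k\in SG^{m_e-N-1,m_\psi}_{cl(\psi)}.$$ **Statement.** Let $E,\tilde E\colon\mathcal S(\mathbb{R}^n)\to\mathcal S(\mathbb{R}^n)$ be $SG$-pseudo-differential operators (of arbitrary real orders, not necessarily classical) which are parametrices of each other, i.e. $E\tilde E-I\in\mathcal RG$ and $\tilde EE-I\in\mathcal RG$, and suppose that $[E,P]=EP-PE\in\mathcal RG$ and $[\tilde E,P]\in\mathcal RG$ for every $P\in LG$. Then there are $c\in\mathbb{C}$, $c\neq0$, and $R\in\mathcal RG$ such that $E=cI+R$. -/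

import Mathlib

open scoped SchwartzMap ContDiff

noncomputable section

namespace SGCalc

/-- The configuration space `ℝⁿ`. -/
abbrev Rn (n : ℕ) := EuclideanSpace ℝ (Fin n)

/-- The Japanese bracket `⟨x⟩ = (1 + |x|²)^(1/2)`. -/
def bracket {n : ℕ} (x : Rn n) : ℝ := Real.sqrt (1 + ‖x‖ ^ 2)

/-- The derivative of `a` in the direction `v`. -/
def dirDeriv {n : ℕ} (v : Rn n × Rn n) (a : Rn n × Rn n → ℂ) : Rn n × Rn n → ℂ :=
  fun z => fderiv ℝ a z v

/-- `∂/∂xᵢ`. -/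
def partialX {n : ℕ} (i : Fin n) (a : Rn n × Rn n → ℂ) : Rn n × Rn n → ℂ :=
  dirDeriv (EuclideanSpace.single i 1, 0) a

/-- `∂/∂ξᵢ`. -/
def partialXi {n : ℕ} (i : Fin n) (a : Rn n × Rn n → ℂ) : Rn n × Rn n → ℂ :=
  dirDeriv (0, EuclideanSpace.single i 1) a

/-- The mixed derivative `∂ₓ^α ∂_ξ^β a`. The multi-indices are written as lists of coordinate
indices, `|α| = I.length` and `|β| = J.length`; for smooth `a` the order in the lists is
immaterial. -/
def mixedDeriv {n : ℕ} (I J : List (Fin n)) (a : Rn n × Rn n → ℂ) : Rn n × Rn n → ℂ :=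
  I.foldr partialX (J.foldr partialXi a)

/-- `a ∈ SG^m(ℝⁿ × ℝⁿ)`, with `m = (m_e, m_ψ)`; classicality is not required. -/
structure IsSymbol {n : ℕ} (m : ℝ × ℝ) (a : Rn n × Rn n → ℂ) : Prop where
  smooth : ContDiff ℝ ∞ a
  bound : ∀ I J : List (Fin n), ∃ C : ℝ, ∀ x ξ : Rn n,
    ‖mixedDeriv I J a (x, ξ)‖ ≤
      C * bracket x ^ (m.1 - (I.length : ℝ)) * bracket ξ ^ (m.2 - (J.length : ℝ))

/-- Homogeneity of degree `d` in `ξ` outside a ball. -/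
def PsiHomog {n : ℕ} (d : ℝ) (a : Rn n × Rn n → ℂ) : Prop :=
  ∃ c : ℝ, 0 < c ∧ ∀ μ : ℝ, 1 ≤ μ → ∀ x ξ : Rn n, c < ‖ξ‖ →
    a (x, μ • ξ) = ((μ ^ d : ℝ) : ℂ) * a (x, ξ)

/-- Homogeneity of degree `d` in `x` outside a ball. -/
def ExitHomog {n : ℕ} (d : ℝ) (a : Rn n × Rn n → ℂ) : Prop :=
  ∃ c : ℝ, 0 < c ∧ ∀ t : ℝ, 1 ≤ t → ∀ x ξ : Rn n, c < ‖x‖ →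
    a (t • x, ξ) = ((t ^ d : ℝ) : ℂ) * a (x, ξ)

/-- Bi-homogeneity of degree `m = (m_e, m_ψ)` for large `x` and `ξ`. -/
def BiHomog {n : ℕ} (m : ℝ × ℝ) (a : Rn n × Rn n → ℂ) : Prop :=
  ∃ c : ℝ, 0 < c ∧ ∀ t μ : ℝ, 1 ≤ t → 1 ≤ μ → ∀ x ξ : Rn n, c < ‖x‖ → c < ‖ξ‖ →
    a (t • x, μ • ξ) = ((t ^ m.1 : ℝ) : ℂ) * ((μ ^ m.2 : ℝ) : ℂ) * a (x, ξ)

/-- The remainder `a - ∑_{k ≤ N} s k` of an expansion. -/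
def remainder {n : ℕ} (a : Rn n × Rn n → ℂ) (s : ℕ → Rn n × Rn n → ℂ) (N : ℕ) :
    Rn n × Rn n → ℂ :=
  fun z => a z - ∑ k ∈ Finset.range (N + 1), s k z

/-- `a ∈ SG^{[m_e],[m_ψ]}`. -/
def IsBiHomogSymbol {n : ℕ} (m : ℝ × ℝ) (a : Rn n × Rn n → ℂ) : Prop :=
  IsSymbol m a ∧ BiHomog m a

/-- `a ∈ SG^{m_e,[m_ψ]}`. -/
def IsPsiHomogSymbol {n : ℕ} (m : ℝ × ℝ) (a : Rn n × Rn n → ℂ) : Prop :=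
  IsSymbol m a ∧ PsiHomog m.2 a

/-- `a ∈ SG^{[m_e],m_ψ}`. -/
def IsExitHomogSymbol {n : ℕ} (m : ℝ × ℝ) (a : Rn n × Rn n → ℂ) : Prop :=
  IsSymbol m a ∧ ExitHomog m.1 a

/-- `a ∈ SG^{[m_e],m_ψ}_{cl(ψ)}`. -/
def IsExitHomogPsiClassical {n : ℕ} (m : ℝ × ℝ) (a : Rn n × Rn n → ℂ) : Prop :=
  IsExitHomogSymbol m a ∧ ∃ s : ℕ → Rn n × Rn n → ℂ,
    (∀ k : ℕ, IsBiHomogSymbol (m.1, m.2 - (k : ℝ)) (s k)) ∧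
    ∀ N : ℕ, IsSymbol (m.1, m.2 - (N : ℝ) - 1) (remainder a s N)

/-- `a ∈ SG^{m_e,m_ψ}_{cl(ψ)}`. -/
def IsPsiClassical {n : ℕ} (m : ℝ × ℝ) (a : Rn n × Rn n → ℂ) : Prop :=
  IsSymbol m a ∧ ∃ s : ℕ → Rn n × Rn n → ℂ,
    (∀ k : ℕ, IsPsiHomogSymbol (m.1, m.2 - (k : ℝ)) (s k)) ∧
    ∀ N : ℕ, IsSymbol (m.1, m.2 - (N : ℝ) - 1) (remainder a s N)

/-- `a ∈ SG^{m_e,[m_ψ]}_{cl(e)}`. -/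
def IsPsiHomogExitClassical {n : ℕ} (m : ℝ × ℝ) (a : Rn n × Rn n → ℂ) : Prop :=
  IsPsiHomogSymbol m a ∧ ∃ s : ℕ → Rn n × Rn n → ℂ,
    (∀ k : ℕ, IsBiHomogSymbol (m.1 - (k : ℝ), m.2) (s k)) ∧
    ∀ N : ℕ, IsSymbol (m.1 - (N : ℝ) - 1, m.2) (remainder a s N)

/-- `a ∈ SG^{m_e,m_ψ}_{cl(e)}`. -/
def IsExitClassical {n : ℕ} (m : ℝ × ℝ) (a : Rn n × Rn n → ℂ) : Prop :=
  IsSymbol m a ∧ ∃ s : ℕ → Rn n × Rn n → ℂ,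
    (∀ k : ℕ, IsExitHomogSymbol (m.1 - (k : ℝ), m.2) (s k)) ∧
    ∀ N : ℕ, IsSymbol (m.1 - (N : ℝ) - 1, m.2) (remainder a s N)

/-- `a ∈ SG^m_{cl}`: classical `SG`-symbols of order `m`. -/
structure IsClassicalSymbol {n : ℕ} (m : ℝ × ℝ) (a : Rn n × Rn n → ℂ) : Prop where
  symbol : IsSymbol m a
  psi_expansion : ∃ s : ℕ → Rn n × Rn n → ℂ,
    (∀ k : ℕ, IsPsiHomogExitClassical (m.1, m.2 - (k : ℝ)) (s k)) ∧
    ∀ N : ℕ, IsExitClassical (m.1, m.2 - (N : ℝ) - 1) (remainder a s N)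
  exit_expansion : ∃ s : ℕ → Rn n × Rn n → ℂ,
    (∀ j : ℕ, IsExitHomogPsiClassical (m.1 - (j : ℝ), m.2) (s j)) ∧
    ∀ N : ℕ, IsPsiClassical (m.1 - (N : ℝ) - 1, m.2) (remainder a s N)

/-- `Op(a)u(x) = (2π)⁻ⁿ ∫ (∫ e^{i(x-y)·ξ} a(x,ξ) u(y) dy) dξ`. For an `SG`-symbol `a` and a
Schwartz function `u` both iterated integrals converge absolutely. -/
def opApply {n : ℕ} (a : Rn n × Rn n → ℂ) (u : 𝓢(Rn n, ℂ)) (x : Rn n) : ℂ :=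
  ((2 * Real.pi : ℝ) : ℂ)⁻¹ ^ n *
    ∫ ξ : Rn n, ∫ y : Rn n,
      Complex.exp (Complex.I * ((inner ℝ (x - y) ξ : ℝ) : ℂ)) * a (x, ξ) * u y

/-- The linear operator `A : 𝓢(ℝⁿ) → 𝓢(ℝⁿ)` is `Op(a)`. -/
def IsOp {n : ℕ} (a : Rn n × Rn n → ℂ) (A : Module.End ℂ 𝓢(Rn n, ℂ)) : Prop :=
  ∀ (u : 𝓢(Rn n, ℂ)) (x : Rn n), A u x = opApply a u x

/-- All `SG`-pseudo-differential operators on `ℝⁿ`, of arbitrary real order, not necessarily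
classical. -/
def SGPsiDO (n : ℕ) : Set (Module.End ℂ 𝓢(Rn n, ℂ)) :=
  {A | ∃ (m : ℝ × ℝ) (a : Rn n × Rn n → ℂ), IsSymbol m a ∧ IsOp a A}

/-- `LG = ⋃_{m ∈ ℤ²} LG^m`: classical `SG`-pseudo-differential operators of integer order. -/
def LG (n : ℕ) : Set (Module.End ℂ 𝓢(Rn n, ℂ)) :=
  {A | ∃ (m : ℤ × ℤ) (a : Rn n × Rn n → ℂ),
    IsClassicalSymbol ((m.1 : ℝ), (m.2 : ℝ)) a ∧ IsOp a A}

/-- `RG = LG^{-∞,-∞}`: operators whose symbol lies in `SG^m` for every order `m`. -/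
def RG (n : ℕ) : Set (Module.End ℂ 𝓢(Rn n, ℂ)) :=
  {A | ∃ a : Rn n × Rn n → ℂ, (∀ m : ℝ × ℝ, IsSymbol m a) ∧ IsOp a A}

/-- `A` and `B` are parametrices of each other. -/
def AreParametrices {n : ℕ} (A B : Module.End ℂ 𝓢(Rn n, ℂ)) : Prop :=
  A * B - 1 ∈ RG n ∧ B * A - 1 ∈ RG n

end SGCalc

end

/-! Only two families of classical operators are needed to test commutation: multiplication by `x_j`
and the momenta `D_j = -i ∂_j`. If E = Op(a), then [E, x_j] = -i Op(∂_{ξ_j} a) and [E, D_j] = i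
Op(∂_{x_j} a) (`opApply_mulCoord`, `hasDerivAt_opApply`). An operator determines its symbol
(`symbol_unique`), so every first derivative of a lies in every SG^m.

Such an a oscillates rapidly little at infinity: integrating its gradient along rays, a tends to a
constant c in all directions of phase space at once, and a - c lies in every SG^m
(`exists_const_sub_isSymbol`). Hence E = c + R, and likewise for the parametrix.

If c were 0, E would be residual, and the parametrix relation would express I through residual
operators. These map L¹ boundedly into L^∞ and into L¹, whereas u ↦ u(0) is not L¹-bounded when n ≥
1 (`not_mul_sub_one_mem_RG`). For n = 0 every operator in question is residual, and c = 1 serves. -/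

namespace SGCalc

open MeasureTheory Real Filter Topology
open scoped FourierTransform LineDeriv

variable {n : ℕ}

/-! ### Elementary bounds for the bracket -/

section Bracket

theorem one_le_bracket (x : Rn n) : 1 ≤ bracket x :=
  Real.one_le_sqrt.2 (by nlinarith [sq_nonneg ‖x‖])

theorem bracket_pos (x : Rn n) : 0 < bracket x := zero_lt_one.trans_le (one_le_bracket x)

theorem sq_bracket (x : Rn n) : bracket x ^ 2 = 1 + ‖x‖ ^ 2 :=
  Real.sq_sqrt (by positivity)

theorem norm_le_bracket (x : Rn n) : ‖x‖ ≤ bracket x :=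
  Real.le_sqrt_of_sq_le (by linarith)


theorem bracket_le_one_add_norm (x : Rn n) : bracket x ≤ 1 + ‖x‖ :=
  Real.sqrt_le_iff.2 ⟨by positivity, by nlinarith [norm_nonneg x]⟩

theorem bracket_rpow_le_pow (x : Rn n) {d : ℝ} {k : ℕ} (h : d ≤ k) :
    bracket x ^ d ≤ (1 + ‖x‖) ^ k :=
  calc bracket x ^ d ≤ bracket x ^ (k : ℝ) := Real.rpow_le_rpow_of_exponent_le (one_le_bracket x) h
    _ = bracket x ^ k := Real.rpow_natCast _ _
    _ ≤ (1 + ‖x‖) ^ k := by gcongr; exacts [(bracket_pos x).le, bracket_le_one_add_norm x]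

end Bracket

/-! ### Symbol estimates; the coordinates as classical symbols -/

section Symbols

/-- The last list entry acts first, so peeling it off turns estimates for a into estimates for a
first derivative, without permuting derivatives. -/
theorem mixedDeriv_append_xi (I J : List (Fin n)) (j : Fin n) (a : Rn n × Rn n → ℂ) :
    mixedDeriv I (J ++ [j]) a = mixedDeriv I J (partialXi j a) := by
  simp [mixedDeriv]

theorem mixedDeriv_append_x (I : List (Fin n)) (i : Fin n) (a : Rn n × Rn n → ℂ) :
    mixedDeriv (I ++ [i]) [] a = mixedDeriv I [] (partialX i a) := by
  simp [mixedDeriv]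

theorem contDiff_dirDeriv {a : Rn n × Rn n → ℂ} (h : ContDiff ℝ ∞ a) (v : Rn n × Rn n) :
    ContDiff ℝ ∞ (dirDeriv v a) :=
  (h.fderiv_right (m := ∞) (by simp)).clm_apply contDiff_const

theorem exists_nonneg_bound {m : ℝ × ℝ} {a : Rn n × Rn n → ℂ} (h : IsSymbol m a)
    (I J : List (Fin n)) : ∃ C : ℝ, 0 ≤ C ∧ ∀ x ξ : Rn n, ‖mixedDeriv I J a (x, ξ)‖ ≤
      C * bracket x ^ (m.1 - (I.length : ℝ)) * bracket ξ ^ (m.2 - (J.length : ℝ)) := by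
  obtain ⟨C, hC⟩ := h.bound I J
  refine ⟨|C|, abs_nonneg C, fun x ξ => (hC x ξ).trans ?_⟩
  have := bracket_pos x
  have := bracket_pos ξ
  gcongr
  exact le_abs_self C

theorem exists_pow_bound {m : ℝ × ℝ} {a : Rn n × Rn n → ℂ} (h : IsSymbol m a)
    (I J : List (Fin n)) : ∃ (C : ℝ) (k : ℕ), 0 ≤ C ∧ ∀ x ξ : Rn n,
      ‖mixedDeriv I J a (x, ξ)‖ ≤ C * (1 + ‖x‖) ^ k * (1 + ‖ξ‖) ^ k := by
  obtain ⟨C, hC0, hC⟩ := exists_nonneg_bound h I J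
  obtain ⟨k, hk⟩ := exists_nat_ge (max m.1 m.2)
  refine ⟨C, k, hC0, fun x ξ => (hC x ξ).trans ?_⟩
  have h1 : m.1 - (I.length : ℝ) ≤ k := by
    have := (le_max_left _ _).trans hk
    have : (0 : ℝ) ≤ I.length := by positivity
    linarith
  have h2 : m.2 - (J.length : ℝ) ≤ k := by
    have := (le_max_right _ _).trans hk
    have : (0 : ℝ) ≤ J.length := by positivity
    linarith
  have := Real.rpow_nonneg (bracket_pos ξ).le (m.2 - (J.length : ℝ))
  exact mul_le_mul (mul_le_mul_of_nonneg_left (bracket_rpow_le_pow x h1) hC0)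
    (bracket_rpow_le_pow ξ h2) this (by positivity)

theorem mixedDeriv_zero (I J : List (Fin n)) :
    mixedDeriv I J (fun _ => (0 : ℂ)) = fun _ => 0 := by
  have hX : ∀ i : Fin n, partialX i (fun _ => (0 : ℂ)) = fun _ => 0 := fun i => by
    ext z; simp [partialX, dirDeriv]
  have hXi : ∀ i : Fin n, partialXi i (fun _ => (0 : ℂ)) = fun _ => 0 := fun i => by
    ext z; simp [partialXi, dirDeriv]
  have hJ : J.foldr partialXi (fun _ => (0 : ℂ)) = fun _ => 0 := by
    induction J with
    | nil => rfl
    | cons j J ih => rw [List.foldr_cons, ih, hXi]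
  rw [mixedDeriv, hJ]
  induction I with
  | nil => rfl
  | cons i I ih => rw [List.foldr_cons, ih, hX]

theorem isSymbol_zero (m : ℝ × ℝ) : IsSymbol m (fun _ : Rn n × Rn n => (0 : ℂ)) where
  smooth := contDiff_const
  bound I J := ⟨0, fun x ξ => by simp [mixedDeriv_zero]⟩

/-- A symbol is its own expansion if it is homogeneous in both variables. -/
theorem isClassicalSymbol_of_homog {m : ℝ × ℝ} {a : Rn n × Rn n → ℂ} (h : IsSymbol m a)
    (hψ : ∀ μ : ℝ, 1 ≤ μ → ∀ x ξ : Rn n, a (x, μ • ξ) = ((μ ^ m.2 : ℝ) : ℂ) * a (x, ξ))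
    (he : ∀ t : ℝ, 1 ≤ t → ∀ x ξ : Rn n, a (t • x, ξ) = ((t ^ m.1 : ℝ) : ℂ) * a (x, ξ)) :
    IsClassicalSymbol m a := by
  have hB : BiHomog m a := ⟨1, one_pos, fun t μ ht hμ x ξ _ _ => by
    rw [he t ht, hψ μ hμ, mul_assoc]⟩
  have hP : PsiHomog m.2 a := ⟨1, one_pos, fun μ hμ x ξ _ => hψ μ hμ x ξ⟩
  have hE : ExitHomog m.1 a := ⟨1, one_pos, fun t ht x ξ _ => he t ht x ξ⟩
  have zB : ∀ d, BiHomog d (fun _ : Rn n × Rn n => (0 : ℂ)) := fun d => ⟨1, one_pos, by simp⟩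
  have zP : ∀ d, PsiHomog d (fun _ : Rn n × Rn n => (0 : ℂ)) := fun d => ⟨1, one_pos, by simp⟩
  have zE : ∀ d, ExitHomog d (fun _ : Rn n × Rn n => (0 : ℂ)) := fun d => ⟨1, one_pos, by simp⟩
  -- A one-term expansion: every partial sum contains the index 0, so all remainders vanish. The
  -- same sequence serves in both variables and for the inner expansions.
  let s : ℕ → Rn n × Rn n → ℂ := fun k => if k = 0 then a else fun _ => 0
  have hr : ∀ N, remainder a s N = fun _ => 0 := fun N => by
    ext z
    have : ∀ k, s k z = if k = 0 then a z else 0 := fun k => by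
      simp only [s]; split_ifs <;> rfl
    simp [remainder, this]
  have z0 : ∀ N, remainder (fun _ : Rn n × Rn n => (0 : ℂ)) (fun _ _ => 0) N = fun _ => 0 :=
    fun N => by ext z; simp [remainder]
  refine ⟨h, ⟨s, fun k => ?_, fun N => ?_⟩, ⟨s, fun k => ?_, fun N => ?_⟩⟩
  · rcases eq_or_ne k 0 with rfl | hk
    · refine ⟨⟨by simpa [s] using h, by simpa [s] using hP⟩, s, fun k => ?_, fun N => ?_⟩
      · rcases eq_or_ne k 0 with rfl | hk
        · exact ⟨by simpa [s] using h, by simpa [s] using hB⟩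
        · simpa [s, hk] using ⟨isSymbol_zero _, zB _⟩
      · have : s 0 = a := rfl
        rw [this, hr]; exact isSymbol_zero _
    · simp only [s, hk, if_false]
      exact ⟨⟨isSymbol_zero _, zP _⟩, fun _ _ => 0, fun _ => ⟨isSymbol_zero _, zB _⟩,
        fun N => by rw [z0]; exact isSymbol_zero _⟩
  · rw [hr]
    exact ⟨isSymbol_zero _, fun _ _ => 0, fun _ => ⟨isSymbol_zero _, zE _⟩,
      fun N => by rw [z0]; exact isSymbol_zero _⟩
  · rcases eq_or_ne k 0 with rfl | hk
    · refine ⟨⟨by simpa [s] using h, by simpa [s] using hE⟩, s, fun k => ?_, fun N => ?_⟩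
      · rcases eq_or_ne k 0 with rfl | hk
        · exact ⟨by simpa [s] using h, by simpa [s] using hB⟩
        · simpa [s, hk] using ⟨isSymbol_zero _, zB _⟩
      · have : s 0 = a := rfl
        rw [this, hr]; exact isSymbol_zero _
    · simp only [s, hk, if_false]
      exact ⟨⟨isSymbol_zero _, zE _⟩, fun _ _ => 0, fun _ => ⟨isSymbol_zero _, zB _⟩,
        fun N => by rw [z0]; exact isSymbol_zero _⟩
  · rw [hr]
    exact ⟨isSymbol_zero _, fun _ _ => 0, fun _ => ⟨isSymbol_zero _, zP _⟩,
      fun N => by rw [z0]; exact isSymbol_zero _⟩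

theorem mixedDeriv_const_of_ne {I J : List (Fin n)} (h : I ≠ [] ∨ J ≠ []) (c : ℂ) :
    mixedDeriv I J (fun _ => c) = fun _ => 0 := by
  rcases List.eq_nil_or_concat' J with rfl | ⟨J, j, rfl⟩
  · rcases List.eq_nil_or_concat' I with rfl | ⟨I, i, rfl⟩
    · simp at h
    · rw [mixedDeriv_append_x, ← mixedDeriv_zero I []]
      congr 1; ext z; simp [partialX, dirDeriv]
  · rw [mixedDeriv_append_xi, ← mixedDeriv_zero I J]
    congr 1; ext z; simp [partialXi, dirDeriv]

theorem partialX_clm (L : Rn n × Rn n →L[ℝ] ℂ) (i : Fin n) :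
    partialX i L = fun _ => L (EuclideanSpace.single i 1, 0) := by
  ext z; simp [partialX, dirDeriv]

theorem partialXi_clm (L : Rn n × Rn n →L[ℝ] ℂ) (i : Fin n) :
    partialXi i L = fun _ => L (0, EuclideanSpace.single i 1) := by
  ext z; simp [partialXi, dirDeriv]

/-- The coordinate function `x_j` as a linear functional on phase space. -/
noncomputable def coordX (j : Fin n) : Rn n × Rn n →L[ℝ] ℂ :=
  Complex.ofRealCLM ∘L EuclideanSpace.proj j ∘L ContinuousLinearMap.fst ℝ (Rn n) (Rn n)

/-- The coordinate function `ξ_j` as a linear functional on phase space. -/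
noncomputable def coordXi (j : Fin n) : Rn n × Rn n →L[ℝ] ℂ :=
  Complex.ofRealCLM ∘L EuclideanSpace.proj j ∘L ContinuousLinearMap.snd ℝ (Rn n) (Rn n)

theorem coordX_apply (j : Fin n) (z : Rn n × Rn n) : coordX j z = (z.1 j : ℂ) := rfl

theorem coordXi_apply (j : Fin n) (z : Rn n × Rn n) : coordXi j z = (z.2 j : ℂ) := rfl

/-- One x-derivative gives a constant, matching the weight of exponent 1 - 1 = 0; a second
x-derivative or any ξ-derivative gives zero. -/
theorem isSymbol_coordX (j : Fin n) : IsSymbol (1, 0) (coordX j) where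
  smooth := (coordX j).contDiff
  bound I J := by
    rcases List.eq_nil_or_concat' J with rfl | ⟨J, k, rfl⟩
    · rcases List.eq_nil_or_concat' I with rfl | ⟨I, i, rfl⟩
      · refine ⟨1, fun x ξ => ?_⟩
        simpa [mixedDeriv, coordX_apply] using (PiLp.norm_apply_le x j).trans (norm_le_bracket x)
      · rcases List.eq_nil_or_concat' I with rfl | ⟨I, k, rfl⟩
        · refine ⟨‖coordX j (EuclideanSpace.single i 1, 0)‖, fun x ξ => ?_⟩
          simp [mixedDeriv, partialX_clm]
        · refine ⟨0, fun x ξ => ?_⟩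
          rw [mixedDeriv_append_x, partialX_clm, mixedDeriv_const_of_ne (by simp)]
          simp
    · refine ⟨0, fun x ξ => ?_⟩
      have : partialXi k (coordX j) = fun _ => 0 := by
        rw [partialXi_clm]; ext; simp [coordX_apply]
      rw [mixedDeriv_append_xi, this, mixedDeriv_zero]
      simp

theorem isSymbol_coordXi (j : Fin n) : IsSymbol (0, 1) (coordXi j) where
  smooth := (coordXi j).contDiff
  bound I J := by
    rcases List.eq_nil_or_concat' J with rfl | ⟨J, k, rfl⟩
    · rcases List.eq_nil_or_concat' I with rfl | ⟨I, i, rfl⟩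
      · refine ⟨1, fun x ξ => ?_⟩
        simpa [mixedDeriv, coordXi_apply] using (PiLp.norm_apply_le ξ j).trans (norm_le_bracket ξ)
      · refine ⟨0, fun x ξ => ?_⟩
        have : partialX i (coordXi j) = fun _ => 0 := by
          rw [partialX_clm]; ext; simp [coordXi_apply]
        rw [mixedDeriv_append_x, this, mixedDeriv_zero]
        simp
    · by_cases h : I ≠ [] ∨ J ≠ []
      · refine ⟨0, fun x ξ => ?_⟩
        rw [mixedDeriv_append_xi, partialXi_clm, mixedDeriv_const_of_ne h]
        simp
      · obtain ⟨rfl, rfl⟩ : I = [] ∧ J = [] := by simpa using h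
        refine ⟨‖coordXi j (0, EuclideanSpace.single k 1)‖, fun x ξ => ?_⟩
        simp [mixedDeriv, partialXi_clm]

theorem isClassicalSymbol_coordX (j : Fin n) : IsClassicalSymbol (1, 0) (coordX j) :=
  isClassicalSymbol_of_homog (isSymbol_coordX j) (by simp [coordX_apply]) (by simp [coordX_apply])

theorem isClassicalSymbol_coordXi (j : Fin n) : IsClassicalSymbol (0, 1) (coordXi j) :=
  isClassicalSymbol_of_homog (isSymbol_coordXi j) (by simp [coordXi_apply])
    (by simp [coordXi_apply])

end Symbols

/-! ### Fourier representation, uniqueness of symbols, position and momentum -/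

section Operators

/-- Continuous functions on phase space bounded by a polynomial. -/
def ModerateGrowth (a : Rn n × Rn n → ℂ) : Prop :=
  Continuous a ∧ ∃ (C : ℝ) (k : ℕ), 0 ≤ C ∧ ∀ x ξ : Rn n,
    ‖a (x, ξ)‖ ≤ C * (1 + ‖x‖) ^ k * (1 + ‖ξ‖) ^ k

theorem IsSymbol.moderateGrowth {m : ℝ × ℝ} {a : Rn n × Rn n → ℂ} (h : IsSymbol m a) :
    ModerateGrowth a :=
  ⟨h.smooth.continuous, exists_pow_bound h [] []⟩

theorem IsSymbol.moderateGrowth_partialX {m : ℝ × ℝ} {a : Rn n × Rn n → ℂ} (h : IsSymbol m a)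
    (i : Fin n) : ModerateGrowth (partialX i a) :=
  ⟨(contDiff_dirDeriv h.smooth _).continuous, exists_pow_bound h [i] []⟩

theorem IsSymbol.moderateGrowth_partialXi {m : ℝ × ℝ} {a : Rn n × Rn n → ℂ} (h : IsSymbol m a)
    (i : Fin n) : ModerateGrowth (partialXi i a) :=
  ⟨(contDiff_dirDeriv h.smooth _).continuous, exists_pow_bound h [] [i]⟩

/-- The oscillating factor `e^{2πi x·η}`. -/
noncomputable def phase (x η : Rn n) : ℂ := Complex.exp (↑(2 * π * inner ℝ η x) * Complex.I)

theorem norm_phase (x η : Rn n) : ‖phase x η‖ = 1 := Complex.norm_exp_ofReal_mul_I _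

theorem continuous_phase (x : Rn n) : Continuous (phase x) := by
  unfold phase; fun_prop

theorem integrable_one_add_norm_pow_mul (f : 𝓢(Rn n, ℂ)) (k : ℕ) :
    Integrable (fun η => (1 + ‖η‖) ^ k * ‖f η‖) := by
  have h0 := (f.integrable_pow_mul volume 0).add (f.integrable_pow_mul volume k)
  refine (h0.const_mul (2 ^ (k - 1))).mono' (by fun_prop) (.of_forall fun η => ?_)
  rw [Real.norm_of_nonneg (by positivity)]
  calc (1 + ‖η‖) ^ k * ‖f η‖ ≤ (2 ^ (k - 1) * (1 ^ k + ‖η‖ ^ k)) * ‖f η‖ := by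
        gcongr; exact add_pow_le zero_le_one (norm_nonneg _) k
    _ = _ := by simp; ring

theorem norm_amplitude_le {a : Rn n × Rn n → ℂ} {C : ℝ} {k : ℕ} (hC : 0 ≤ C)
    (h : ∀ x ξ : Rn n, ‖a (x, ξ)‖ ≤ C * (1 + ‖x‖) ^ k * (1 + ‖ξ‖) ^ k) (x η : Rn n) :
    ‖a (x, (2 * π) • η)‖ ≤ C * (1 + 2 * π) ^ k * (1 + ‖x‖) ^ k * (1 + ‖η‖) ^ k := by
  refine (h x _).trans ?_
  have : 1 + ‖(2 * π) • η‖ ≤ (1 + 2 * π) * (1 + ‖η‖) := by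
    rw [norm_smul, Real.norm_of_nonneg (by positivity)]
    nlinarith [norm_nonneg η, pi_pos]
  calc C * (1 + ‖x‖) ^ k * (1 + ‖(2 * π) • η‖) ^ k
      ≤ C * (1 + ‖x‖) ^ k * ((1 + 2 * π) * (1 + ‖η‖)) ^ k := by gcongr
    _ = _ := by rw [mul_pow]; ring

theorem integrable_amplitude_mul {a : Rn n × Rn n → ℂ} (h : ModerateGrowth a) (f : 𝓢(Rn n, ℂ))
    (x : Rn n) : Integrable (fun η => phase x η * a (x, (2 * π) • η) * f η) := by
  obtain ⟨hc, C, k, hC, h⟩ := h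
  refine ((integrable_one_add_norm_pow_mul f k).const_mul
    (C * (1 + 2 * π) ^ k * (1 + ‖x‖) ^ k)).mono' ?_ (.of_forall fun η => ?_)
  · have := continuous_phase x
    exact Continuous.aestronglyMeasurable (by fun_prop)
  · rw [norm_mul, norm_mul, norm_phase, one_mul, ← mul_assoc]
    gcongr
    exact norm_amplitude_le hC h x η

/-- The substitution ξ = 2πη absorbs the factor (2π)⁻ⁿ and makes the inner integral the Fourier
transform with kernel e^{-2πi y·η}. -/
theorem opApply_eq (a : Rn n × Rn n → ℂ) (u : 𝓢(Rn n, ℂ)) (x : Rn n) :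
    opApply a u x = ∫ η, phase x η * a (x, (2 * π) • η) * 𝓕 u η := by
  have hπ : (2 * π) ≠ 0 := by positivity
  set F : Rn n → ℂ := fun ξ => ∫ y : Rn n,
      Complex.exp (Complex.I * ((inner ℝ (x - y) ξ : ℝ) : ℂ)) * a (x, ξ) * u y with hF
  have h1 : ∀ η, F ((2 * π) • η) = phase x η * a (x, (2 * π) • η) * 𝓕 u η := fun η => by
    rw [SchwartzMap.fourier_coe, Real.fourier_eq', ← integral_const_mul]
    refine integral_congr_ae (.of_forall fun y => ?_)
    have : Complex.exp (Complex.I * ((inner ℝ (x - y) ((2 * π) • η) : ℝ) : ℂ)) =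
        phase x η * Complex.exp (↑(-2 * π * inner ℝ y η) * Complex.I) := by
      rw [phase, ← Complex.exp_add, inner_smul_right, inner_sub_left, real_inner_comm x η]
      congr 1; push_cast; ring
    simp only [this, smul_eq_mul]
    ring
  have h2 := Measure.integral_comp_smul (volume : Measure (Rn n)) F (2 * π)
  simp_rw [h1] at h2
  rw [h2, opApply, finrank_euclideanSpace_fin, abs_of_pos (by positivity), Complex.real_smul]
  push_cast
  rw [inv_pow]

theorem opApply_one (u : 𝓢(Rn n, ℂ)) (x : Rn n) : opApply (fun _ => 1) u x = u x := by
  rw [opApply_eq]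
  conv_rhs => rw [← FourierTransform.fourierInv_fourier_eq (F := 𝓢(Rn n, ℂ)) u, SchwartzMap.fourierInv_coe,
    Real.fourierInv_eq']
  simp [phase]

theorem opApply_mul_left (a : Rn n × Rn n → ℂ) (c : Rn n → ℂ) (u : 𝓢(Rn n, ℂ)) (x : Rn n) :
    opApply (fun z => c z.1 * a z) u x = c x * opApply a u x := by
  rw [opApply_eq, opApply_eq, ← integral_const_mul]
  congr 1; ext η; ring

theorem opApply_sub {a b : Rn n × Rn n → ℂ} (ha : ModerateGrowth a) (hb : ModerateGrowth b)
    (u : 𝓢(Rn n, ℂ)) (x : Rn n) :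
    opApply (fun z => a z - b z) u x = opApply a u x - opApply b u x := by
  simp_rw [opApply_eq]
  rw [← integral_sub (integrable_amplitude_mul ha _ x) (integrable_amplitude_mul hb _ x)]
  congr 1; ext η; ring

/-- The symbol of an operator is unique. -/
theorem symbol_unique {a b : Rn n × Rn n → ℂ} (ha : ModerateGrowth a) (hb : ModerateGrowth b)
    (h : ∀ (u : 𝓢(Rn n, ℂ)) (x : Rn n), opApply a u x = opApply b u x) : a = b := by
  have key : ∀ x, (fun η => phase x η * (a (x, (2 * π) • η) - b (x, (2 * π) • η))) =
      fun _ => 0 := fun x => by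
    have hc : Continuous fun η => phase x η * (a (x, (2 * π) • η) - b (x, (2 * π) • η)) := by
      have := continuous_phase x
      have := ha.1
      have := hb.1
      fun_prop
    refine Continuous.ae_eq_iff_eq volume hc continuous_const |>.1 ?_
    refine ae_eq_zero_of_integral_contDiff_smul_eq_zero hc.locallyIntegrable fun g hg hgc => ?_
    have hg₁ : HasCompactSupport (Complex.ofRealCLM ∘ g) := hgc.comp_left rfl
    have hg₂ : ContDiff ℝ ∞ (Complex.ofRealCLM ∘ g) := by fun_prop
    -- Choosing u with Fourier transform g tests the difference of amplitudes against an arbitrary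
    -- bump in η.
    have := opApply_sub ha hb (𝓕⁻ (hg₁.toSchwartzMap hg₂)) x
    rw [h, sub_self, opApply_eq, FourierTransform.fourier_fourierInv_eq] at this
    rw [← this]
    congr 1; ext η
    simp [mul_comm]
  ext ⟨x, ξ⟩
  have h1 := congr_fun (key x) ((2 * π)⁻¹ • ξ)
  have h2 : phase x ((2 * π)⁻¹ • ξ) ≠ 0 := Complex.exp_ne_zero _
  rw [smul_inv_smul₀ (by positivity)] at h1
  exact sub_eq_zero.1 ((mul_eq_zero.1 h1).resolve_left h2)

theorem inner_single_one (x : Rn n) (j : Fin n) :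
    inner ℝ x (EuclideanSpace.single j (1 : ℝ)) = x j := by
  simp [EuclideanSpace.inner_single_right]

/-- Multiplication by the coordinate `x_j`. -/
noncomputable def mulCoord (j : Fin n) : Module.End ℂ 𝓢(Rn n, ℂ) :=
  (SchwartzMap.smulLeftCLM ℂ fun x : Rn n =>
    ((inner ℝ x (EuclideanSpace.single j 1) : ℝ) : ℂ)).toLinearMap

theorem mulCoord_apply (j : Fin n) (u : 𝓢(Rn n, ℂ)) (x : Rn n) : mulCoord j u x = x j * u x := by
  have h : Function.HasTemperateGrowth fun x : Rn n =>
    ((inner ℝ x (EuclideanSpace.single j 1) : ℝ) : ℂ) := by fun_prop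
  simp only [inner_single_one] at h
  simp [mulCoord, SchwartzMap.smulLeftCLM_apply_apply h, inner_single_one]

theorem isOp_mulCoord (j : Fin n) : IsOp (coordX j) (mulCoord j) := fun u x => by
  rw [mulCoord_apply, ← opApply_one u x, ← opApply_mul_left (fun _ => 1) (fun x => (x j : ℂ)) u x]
  congr 1; ext z; rw [coordX_apply, mul_one]

/-- The momentum operator `-i ∂_j`. -/
noncomputable def momentum (j : Fin n) : Module.End ℂ 𝓢(Rn n, ℂ) :=
  (-Complex.I) • (LineDeriv.lineDerivOpCLM ℂ 𝓢(Rn n, ℂ) (EuclideanSpace.single j (1 : ℝ))).toLinearMap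

theorem momentum_apply (j : Fin n) (u : 𝓢(Rn n, ℂ)) :
    momentum j u = (-Complex.I) • ∂_{EuclideanSpace.single j (1 : ℝ)} u := rfl

theorem fourier_lineDeriv_single (j : Fin n) (u : 𝓢(Rn n, ℂ)) (η : Rn n) :
    𝓕 (∂_{EuclideanSpace.single j (1 : ℝ)} u) η = 2 * π * Complex.I * η j * 𝓕 u η := by
  have h : Function.HasTemperateGrowth fun x : Rn n =>
    (inner ℝ x (EuclideanSpace.single j (1 : ℝ))) := by fun_prop
  simp only [inner_single_one] at h
  rw [SchwartzMap.fourier_lineDerivOp_eq]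
  simp [SchwartzMap.smulLeftCLM_apply_apply h, inner_single_one]
  ring

theorem isOp_momentum (j : Fin n) : IsOp (coordXi j) (momentum j) := fun u x => by
  rw [momentum_apply, smul_apply,
    ← opApply_one (∂_{EuclideanSpace.single j (1 : ℝ)} u) x, opApply_eq, opApply_eq, smul_eq_mul,
    ← integral_const_mul]
  congr 1; ext η
  rw [fourier_lineDeriv_single, coordXi_apply]
  simp only [PiLp.smul_apply, smul_eq_mul]
  push_cast
  linear_combination (-2 * π * phase x η * η j * 𝓕 u η) * Complex.I_sq

theorem mulCoord_mem_LG (j : Fin n) : mulCoord j ∈ LG n :=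
  ⟨(1, 0), coordX j, by simpa using isClassicalSymbol_coordX j, isOp_mulCoord j⟩

theorem momentum_mem_LG (j : Fin n) : momentum j ∈ LG n :=
  ⟨(0, 1), coordXi j, by simpa using isClassicalSymbol_coordXi j, isOp_momentum j⟩

end Operators

/-! ### Commutation formulas with position and momentum -/

section Commutators

theorem phase_comm (x η : Rn n) : phase x η = phase η x := by
  rw [phase, phase, real_inner_comm]

theorem hasDerivAt_phase (x η v : Rn n) (t : ℝ) :
    HasDerivAt (fun t : ℝ => phase x (η + t • v))
      (2 * π * Complex.I * (inner ℝ v x : ℝ) * phase x (η + t • v)) t := by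
  have h : HasDerivAt (fun t : ℝ => 2 * π * inner ℝ (η + t • v) x) (2 * π * inner ℝ v x) t := by
    simp_rw [inner_add_left, inner_smul_left]
    simpa using ((((hasDerivAt_id t).mul_const (inner ℝ v x)).const_add
      (inner ℝ η x)).const_mul (2 * π))
  refine (h.ofReal_comp.mul_const Complex.I).cexp.congr_deriv ?_
  simp only [phase, real_inner_comm]
  push_cast
  ring

theorem hasDerivAt_line {a : Rn n × Rn n → ℂ} (ha : ContDiff ℝ ∞ a) (z v : Rn n × Rn n) (t : ℝ) :
    HasDerivAt (fun t : ℝ => a (z + t • v)) (dirDeriv v a (z + t • v)) t := by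
  have h := (ha.differentiable (by simp) (z + t • v)).hasFDerivAt
  refine h.comp_hasDerivAt t ?_
  simpa using ((hasDerivAt_id t).smul_const v).const_add z

theorem dirDeriv_smul (c : ℝ) (v : Rn n × Rn n) (a : Rn n × Rn n → ℂ) (z : Rn n × Rn n) :
    dirDeriv (c • v) a z = c * dirDeriv v a z := by
  simp [dirDeriv]

theorem hasLineDerivAt_phase_mul_xi {a : Rn n × Rn n → ℂ} (ha : ContDiff ℝ ∞ a) (x η : Rn n)
    (j : Fin n) :
    HasLineDerivAt ℝ (fun η => phase x η * a (x, (2 * π) • η))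
      (2 * π * Complex.I * x j * (phase x η * a (x, (2 * π) • η)) +
        2 * π * (phase x η * partialXi j a (x, (2 * π) • η))) η (EuclideanSpace.single j 1) := by
  have h1 := hasDerivAt_phase x η (EuclideanSpace.single j 1) 0
  -- The amplitude is evaluated at 2πη, so moving η along e_j moves ξ along 2πe_j.
  have h2 := hasDerivAt_line ha (x, (2 * π) • η) ((2 * π) • (0, EuclideanSpace.single j 1)) 0
  have h := h1.mul h2
  rw [dirDeriv_smul] at h
  unfold HasLineDerivAt
  refine (h.congr_deriv ?_).congr_of_eventuallyEq (.of_forall fun t => ?_)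
  rotate_left
  · simp only [Pi.mul_apply, Prod.smul_mk, Prod.mk_add_mk, smul_zero, add_zero, smul_add]
    rw [smul_comm]
  · rw [real_inner_comm, inner_single_one]
    simp only [zero_smul, add_zero, partialXi]
    push_cast
    ring

theorem fourier_mulCoord (j : Fin n) (u : 𝓢(Rn n, ℂ)) (η : Rn n) :
    ∂_{EuclideanSpace.single j (1 : ℝ)} (𝓕 u) η = -(2 * π * Complex.I) * 𝓕 (mulCoord j u) η := by
  rw [SchwartzMap.lineDerivOp_fourier_eq]
  have : SchwartzMap.smulLeftCLM ℂ (inner ℝ · (EuclideanSpace.single j (1 : ℝ))) u =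
      mulCoord j u := by
    ext x
    rw [mulCoord_apply, SchwartzMap.smulLeftCLM_apply_apply (by fun_prop), inner_single_one,
      Complex.real_smul]
  rw [this, FourierTransform.fourier_smul, smul_apply, smul_eq_mul]

/-- The Fourier transform of `x_j u` is a multiple of the η_j-derivative of that of u. Integrating
by parts, the derivative falls on the phase, giving `x_j`, or on the amplitude, giving ∂_{ξ_j} a. -/
theorem opApply_mulCoord {m : ℝ × ℝ} {a : Rn n × Rn n → ℂ} (ha : IsSymbol m a) (j : Fin n)
    (u : 𝓢(Rn n, ℂ)) (x : Rn n) :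
    opApply a (mulCoord j u) x =
      x j * opApply a u x - Complex.I * opApply (partialXi j a) u x := by
  have i1 := integrable_amplitude_mul ha.moderateGrowth (𝓕 u) x
  have i2 := integrable_amplitude_mul (ha.moderateGrowth_partialXi j) (𝓕 u) x
  have i3 := integrable_amplitude_mul ha.moderateGrowth
    (∂_{EuclideanSpace.single j (1 : ℝ)} (𝓕 u)) x
  have e : ∀ η, (2 * π * Complex.I * x j * (phase x η * a (x, (2 * π) • η)) +
        2 * π * (phase x η * partialXi j a (x, (2 * π) • η))) * 𝓕 u η =
      2 * π * Complex.I * x j * (phase x η * a (x, (2 * π) • η) * 𝓕 u η) +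
        2 * π * (phase x η * partialXi j a (x, (2 * π) • η) * 𝓕 u η) := fun η => by ring
  have key := integral_bilinear_hasLineDerivAt_right_eq_neg_left_of_integrable
    (μ := (volume : Measure (Rn n))) (B := ContinuousLinearMap.mul ℝ ℂ)
    (f := fun η => phase x η * a (x, (2 * π) • η)) (g := ⇑(𝓕 u : 𝓢(Rn n, ℂ)))
    (g' := ⇑(∂_{EuclideanSpace.single j (1 : ℝ)} (𝓕 u) : 𝓢(Rn n, ℂ))) (v := EuclideanSpace.single j (1 : ℝ))
    (f' := fun η => 2 * π * Complex.I * x j * (phase x η * a (x, (2 * π) • η)) +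
        2 * π * (phase x η * partialXi j a (x, (2 * π) • η)))
    (by
      simp only [ContinuousLinearMap.mul_apply', e]
      exact (i1.const_mul _).add (i2.const_mul _))
    (by simpa using i3) (by simpa using i1)
    (fun η _ => hasLineDerivAt_phase_mul_xi ha.smooth x η j)
    (fun η _ => (SchwartzMap.hasFDerivAt (𝓕 u) η).hasLineDerivAt _)
  simp only [ContinuousLinearMap.mul_apply', e] at key
  rw [integral_add (i1.const_mul _) (i2.const_mul _), integral_const_mul, integral_const_mul] at key
  have e2 : ∀ η, phase x η * a (x, (2 * π) • η) * ∂_{EuclideanSpace.single j (1 : ℝ)} (𝓕 u) η =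
      -(2 * π * Complex.I) * (phase x η * a (x, (2 * π) • η) * 𝓕 (mulCoord j u) η) := fun η => by
    rw [fourier_mulCoord]; ring
  simp only [e2] at key
  rw [integral_const_mul] at key
  rw [opApply_eq, opApply_eq, opApply_eq]
  have hπ : (2 * π * Complex.I : ℂ) ≠ 0 := by simp [pi_ne_zero]
  refine mul_left_cancel₀ hπ ?_
  linear_combination -key + (2 * π * ∫ η, phase x η * partialXi j a (x, (2 * π) • η) * 𝓕 u η) *
    Complex.I_sq

theorem hasDerivAt_phase_mul_x {a : Rn n × Rn n → ℂ} (ha : ContDiff ℝ ∞ a) (x η ξ : Rn n)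
    (j : Fin n) (t : ℝ) :
    HasDerivAt (fun t : ℝ => phase (x + t • EuclideanSpace.single j (1 : ℝ)) η *
        a (x + t • EuclideanSpace.single j (1 : ℝ), ξ))
      (2 * π * Complex.I * η j * (phase (x + t • EuclideanSpace.single j (1 : ℝ)) η *
          a (x + t • EuclideanSpace.single j (1 : ℝ), ξ)) +
        phase (x + t • EuclideanSpace.single j (1 : ℝ)) η *
          partialX j a (x + t • EuclideanSpace.single j (1 : ℝ), ξ)) t := by
  have h1 := hasDerivAt_phase η x (EuclideanSpace.single j 1) t
  have h2 := hasDerivAt_line ha (x, ξ) (EuclideanSpace.single j 1, 0) t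
  have h := h1.mul h2
  refine (h.congr_deriv ?_).congr_of_eventuallyEq (.of_forall fun s => ?_)
  rotate_left
  · simp [phase_comm η]
  · rw [real_inner_comm, inner_single_one]
    simp [partialX, phase_comm η]
    ring

/-- Differentiation under the integral: the phase contributes 2πiη_j, which turns the transform of u
into that of ∂_j u. -/
theorem hasDerivAt_opApply {m : ℝ × ℝ} {a : Rn n × Rn n → ℂ} (ha : IsSymbol m a) (j : Fin n)
    (u : 𝓢(Rn n, ℂ)) (x : Rn n) :
    HasDerivAt (fun t : ℝ => opApply a u (x + t • EuclideanSpace.single j (1 : ℝ)))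
      (opApply a (∂_{EuclideanSpace.single j (1 : ℝ)} u) x + opApply (partialX j a) u x) 0 := by
  set e : Rn n := EuclideanSpace.single j (1 : ℝ) with he
  have i1 := fun x => integrable_amplitude_mul ha.moderateGrowth (𝓕 u) x
  have i2 := fun x => integrable_amplitude_mul (ha.moderateGrowth_partialX j) (𝓕 u) x
  have i3 := fun x => integrable_amplitude_mul ha.moderateGrowth (𝓕 (∂_{e} u)) x
  obtain ⟨-, C₁, k₁, hC₁, hb₁⟩ := ha.moderateGrowth
  obtain ⟨-, C₂, k₂, hC₂, hb₂⟩ := ha.moderateGrowth_partialX j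
  -- For |t| < 1 one has 1 + |x + te| ≤ 2 + |x|, so these constants dominate uniformly in t.
  set D₁ := C₁ * (1 + 2 * π) ^ k₁ * (2 + ‖x‖) ^ k₁
  set D₂ := C₂ * (1 + 2 * π) ^ k₂ * (2 + ‖x‖) ^ k₂
  have hx : ∀ t ∈ Metric.ball (0 : ℝ) 1, 1 + ‖x + t • e‖ ≤ 2 + ‖x‖ := fun t ht => by
    have h1 : ‖t • e‖ ≤ 1 := by
      rw [norm_smul, he, PiLp.norm_single]
      simpa using (mem_ball_zero_iff.1 ht).le
    linarith [norm_add_le x (t • e)]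
  have key := hasDerivAt_integral_of_dominated_loc_of_deriv_le
    (μ := (volume : Measure (Rn n))) (x₀ := (0 : ℝ)) (Metric.ball_mem_nhds 0 one_pos)
    (F := fun t η => phase (x + t • e) η * a (x + t • e, (2 * π) • η) * 𝓕 u η)
    (F' := fun t η => phase (x + t • e) η * a (x + t • e, (2 * π) • η) * 𝓕 (∂_{e} u) η +
      phase (x + t • e) η * partialX j a (x + t • e, (2 * π) • η) * 𝓕 u η)
    (bound := fun η => D₁ * ((1 + ‖η‖) ^ k₁ * ‖𝓕 (∂_{e} u) η‖) +
      D₂ * ((1 + ‖η‖) ^ k₂ * ‖𝓕 u η‖))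
    (.of_forall fun t => (i1 _).aestronglyMeasurable) (i1 _)
    ((i3 _).add (i2 _)).aestronglyMeasurable
    (.of_forall fun η t ht => by
      refine (norm_add_le _ _).trans (add_le_add ?_ ?_)
      · rw [norm_mul, norm_mul, norm_phase, one_mul, ← mul_assoc]
        gcongr
        refine (norm_amplitude_le hC₁ hb₁ _ _).trans ?_
        gcongr
        exact mul_le_mul_of_nonneg_left (pow_le_pow_left₀ (by positivity) (hx t ht) _)
          (by positivity)
      · rw [norm_mul, norm_mul, norm_phase, one_mul, ← mul_assoc]
        gcongr
        refine (norm_amplitude_le hC₂ hb₂ _ _).trans ?_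
        gcongr
        exact mul_le_mul_of_nonneg_left (pow_le_pow_left₀ (by positivity) (hx t ht) _)
          (by positivity))
    (((integrable_one_add_norm_pow_mul _ _).const_mul _).add
      ((integrable_one_add_norm_pow_mul _ _).const_mul _))
    (.of_forall fun η t _ => by
      refine ((hasDerivAt_phase_mul_x ha.smooth x η ((2 * π) • η) j t).mul_const
        (𝓕 u η)).congr_deriv ?_
      rw [fourier_lineDeriv_single]
      ring)
  simp_rw [opApply_eq]
  rw [← integral_add (by simpa using i3 x) (by simpa using i2 x)]
  simpa using key.2

end Commutators

/-! ### First derivatives of the symbol are residual -/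

section SymbolOfCommutator

theorem mixedDeriv_const_mul (c : ℂ) (I J : List (Fin n)) (a : Rn n × Rn n → ℂ) :
    mixedDeriv I J (fun z => c * a z) = fun z => c * mixedDeriv I J a z := by
  have hd : ∀ v (b : Rn n × Rn n → ℂ),
      dirDeriv v (fun z => c * b z) = fun z => c * dirDeriv v b z := fun v b => by
    ext z
    have := fderiv_const_smul_field (𝕜 := ℝ) (f := b) c
    simp only [dirDeriv]
    change fderiv ℝ (c • b) z v = _
    rw [this, Pi.smul_apply]; rfl
  have hJ : J.foldr partialXi (fun z => c * a z) = fun z => c * J.foldr partialXi a z := by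
    induction J with
    | nil => rfl
    | cons j J ih => rw [List.foldr_cons, ih, partialXi, hd]; rfl
  rw [mixedDeriv, hJ]
  induction I with
  | nil => rfl
  | cons i I ih => rw [List.foldr_cons, ih, partialX, hd]; rfl

theorem IsSymbol.const_mul {m : ℝ × ℝ} {a : Rn n × Rn n → ℂ} (h : IsSymbol m a) (c : ℂ) :
    IsSymbol m (fun z => c * a z) where
  smooth := contDiff_const.mul h.smooth
  bound I J := by
    obtain ⟨C, hC⟩ := h.bound I J
    refine ⟨‖c‖ * C, fun x ξ => ?_⟩
    rw [mixedDeriv_const_mul, norm_mul, mul_assoc, mul_assoc, ← mul_assoc C]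
    gcongr
    exact hC x ξ

theorem isSymbol_partialXi_of_commutator {m : ℝ × ℝ} {a : Rn n × Rn n → ℂ}
    {A : Module.End ℂ 𝓢(Rn n, ℂ)} (ha : IsSymbol m a) (hA : IsOp a A) {j : Fin n}
    (h : A * mulCoord j - mulCoord j * A ∈ RG n) (d : ℝ × ℝ) : IsSymbol d (partialXi j a) := by
  obtain ⟨r, hr, hop⟩ := h
  have : partialXi j a = fun z => Complex.I * r z := by
    refine symbol_unique (ha.moderateGrowth_partialXi j)
      ((hr 0).const_mul Complex.I).moderateGrowth fun u x => ?_
    rw [opApply_mul_left r (fun _ => Complex.I), ← hop u x]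
    simp only [LinearMap.sub_apply, Module.End.mul_apply, sub_apply]
    rw [mulCoord_apply, hA, hA, opApply_mulCoord ha]
    linear_combination opApply (partialXi j a) u x * Complex.I_sq
  rw [this]
  exact (hr d).const_mul _

theorem isSymbol_partialX_of_commutator {m : ℝ × ℝ} {a : Rn n × Rn n → ℂ}
    {A : Module.End ℂ 𝓢(Rn n, ℂ)} (ha : IsSymbol m a) (hA : IsOp a A) {j : Fin n}
    (h : A * momentum j - momentum j * A ∈ RG n) (d : ℝ × ℝ) : IsSymbol d (partialX j a) := by
  obtain ⟨r, hr, hop⟩ := h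
  have : partialX j a = fun z => -Complex.I * r z := by
    refine symbol_unique (ha.moderateGrowth_partialX j)
      ((hr 0).const_mul (-Complex.I)).moderateGrowth fun u x => ?_
    have h1 := (SchwartzMap.hasFDerivAt (A u) x).hasLineDerivAt (EuclideanSpace.single j (1 : ℝ))
    have h2 := hasDerivAt_opApply ha j u x
    unfold HasLineDerivAt at h1
    simp_rw [hA u] at h1
    -- `A u` is itself a Schwartz function; its derivative must agree with the one computed under
    -- the integral.
    have h3 := h1.unique h2
    rw [opApply_mul_left r (fun _ => -Complex.I), ← hop u x]
    simp only [LinearMap.sub_apply, Module.End.mul_apply, sub_apply]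
    rw [momentum_apply, momentum_apply, map_smul, smul_apply, smul_apply, hA,
      SchwartzMap.lineDerivOp_apply_eq_fderiv, h3]
    simp only [smul_eq_mul]
    linear_combination opApply (partialX j a) u x * Complex.I_sq
  rw [this]
  exact (hr d).const_mul _

end SymbolOfCommutator

/-! ### A symbol with residual gradient is a constant plus a residual symbol -/

section Constant

/-- The bound on the derivative integrates to `B * arctan (t * s)`. With s = |v| it is quadratic
decay along a ray, and the resulting π/2 does not depend on the length of v. -/
theorem norm_sub_le_of_arctan_bound {a : Rn n × Rn n → ℂ} (ha : ContDiff ℝ ∞ a)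
    (z v : Rn n × Rn n) {B s : ℝ}
    (h : ∀ t : ℝ, ‖dirDeriv v a (z + t • v)‖ ≤ B * (s / (1 + (t * s) ^ 2))) (hB : 0 ≤ B) :
    ‖a (z + v) - a z‖ ≤ B * (π / 2) := by
  have hg : ∀ t, HasDerivAt (fun t : ℝ => a (z + t • v) - a z) (dirDeriv v a (z + t • v)) t :=
    fun t => (hasDerivAt_line ha z v t).sub_const _
  have hb : ∀ t, HasDerivAt (fun t : ℝ => B * arctan (t * s)) (B * (s / (1 + (t * s) ^ 2))) t :=
    fun t => by
      refine ((((hasDerivAt_id t).mul_const s).arctan).const_mul B).congr_deriv ?_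
      simp only [id]; ring
  have := image_norm_le_of_norm_deriv_right_le_deriv_boundary (a := 0) (b := 1)
    (fun t _ => (hg t).continuousAt.continuousWithinAt) (fun t _ => (hg t).hasDerivWithinAt)
    (by simp) hb (fun t _ => h t) (Set.right_mem_Icc.2 zero_le_one)
  simp only [one_smul, one_mul] at this
  exact this.trans (mul_le_mul_of_nonneg_left (arctan_lt_pi_div_two s).le hB)

theorem norm_map_le_sum (L : Rn n →L[ℝ] ℂ) (v : Rn n) :
    ‖L v‖ ≤ (∑ i, ‖L (EuclideanSpace.single i 1)‖) * ‖v‖ := by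
  have hv : v = ∑ i, v i • EuclideanSpace.single i (1 : ℝ) := by
    simpa using ((EuclideanSpace.basisFun (Fin n) ℝ).sum_repr v).symm
  calc ‖L v‖ = ‖∑ i, v i • L (EuclideanSpace.single i 1)‖ := by
        conv_lhs => rw [hv, map_sum]
        simp_rw [map_smul]
    _ ≤ ∑ i, ‖L (EuclideanSpace.single i 1)‖ * ‖v‖ := norm_sum_le_of_le _ fun i _ => by
        rw [norm_smul, mul_comm]
        gcongr
        exact PiLp.norm_apply_le v i
    _ = _ := (Finset.sum_mul ..).symm

theorem bracket_rpow_neg_two (x : Rn n) (t : ℝ) :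
    bracket (t • x) ^ (-2 : ℝ) = (1 + (t * ‖x‖) ^ 2)⁻¹ := by
  rw [Real.rpow_neg (bracket_pos _).le, Real.rpow_two, sq_bracket, norm_smul, mul_pow, mul_pow,
    Real.norm_eq_abs, sq_abs]

/-- The order (-2, p) gives integrable decay in x, while the factor in ξ stays fixed along the path.
Paths run through x = 0, where the bracket along the ray is explicit. -/
theorem exists_oscillation_x_bound {a : Rn n × Rn n → ℂ} (ha : ContDiff ℝ ∞ a)
    (h : ∀ j d, IsSymbol d (partialX j a)) (p : ℝ) :
    ∃ C : ℝ, 0 ≤ C ∧ ∀ x x' ξ : Rn n, ‖a (x, ξ) - a (x', ξ)‖ ≤ C * bracket ξ ^ p := by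
  choose C hC0 hC using fun j => exists_nonneg_bound (h j (-2, p)) [] []
  have hS : 0 ≤ ∑ j, C j := Finset.sum_nonneg fun j _ => hC0 j
  have key : ∀ x ξ : Rn n, ‖a (x, ξ) - a (0, ξ)‖ ≤ (∑ j, C j) * bracket ξ ^ p * (π / 2) :=
    fun x ξ => by
      have hξ := Real.rpow_nonneg (bracket_pos ξ).le p
      have := norm_sub_le_of_arctan_bound ha (0, ξ) (x, 0) (B := (∑ j, C j) * bracket ξ ^ p)
        (s := ‖x‖) (fun t => ?_) (by positivity)
      · simpa using this
      · have h1 := norm_map_le_sum ((fderiv ℝ a ((0, ξ) + t • (x, 0))).comp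
          (ContinuousLinearMap.inl ℝ (Rn n) (Rn n))) x
        refine h1.trans ?_
        have h2 : ∑ j, ‖(fderiv ℝ a ((0, ξ) + t • (x, 0))).comp
            (ContinuousLinearMap.inl ℝ (Rn n) (Rn n)) (EuclideanSpace.single j 1)‖ ≤
            ∑ j, C j * (1 + (t * ‖x‖) ^ 2)⁻¹ * bracket ξ ^ p := by
          refine Finset.sum_le_sum fun j _ => ?_
          have := hC j (t • x) ξ
          simp only [List.length_nil, Nat.cast_zero, sub_zero, bracket_rpow_neg_two] at this
          simpa [mixedDeriv, partialX, dirDeriv] using this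
        refine (mul_le_mul_of_nonneg_right h2 (norm_nonneg x)).trans_eq ?_
        rw [← Finset.sum_mul, ← Finset.sum_mul, div_eq_mul_inv]
        ring
  refine ⟨(∑ j, C j) * π, by positivity, fun x x' ξ => ?_⟩
  calc ‖a (x, ξ) - a (x', ξ)‖ = ‖(a (x, ξ) - a (0, ξ)) - (a (x', ξ) - a (0, ξ))‖ := by congr 1; ring
    _ ≤ _ := norm_sub_le _ _
    _ ≤ _ := add_le_add (key x ξ) (key x' ξ)
    _ = _ := by ring

theorem exists_oscillation_xi_bound {a : Rn n × Rn n → ℂ} (ha : ContDiff ℝ ∞ a)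
    (h : ∀ j d, IsSymbol d (partialXi j a)) (p : ℝ) :
    ∃ C : ℝ, 0 ≤ C ∧ ∀ x ξ ξ' : Rn n, ‖a (x, ξ) - a (x, ξ')‖ ≤ C * bracket x ^ p := by
  choose C hC0 hC using fun j => exists_nonneg_bound (h j (p, -2)) [] []
  have hS : 0 ≤ ∑ j, C j := Finset.sum_nonneg fun j _ => hC0 j
  have key : ∀ x ξ : Rn n, ‖a (x, ξ) - a (x, 0)‖ ≤ (∑ j, C j) * bracket x ^ p * (π / 2) :=
    fun x ξ => by
      have hx := Real.rpow_nonneg (bracket_pos x).le p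
      have := norm_sub_le_of_arctan_bound ha (x, 0) (0, ξ) (B := (∑ j, C j) * bracket x ^ p)
        (s := ‖ξ‖) (fun t => ?_) (by positivity)
      · simpa using this
      · have h1 := norm_map_le_sum ((fderiv ℝ a ((x, 0) + t • (0, ξ))).comp
          (ContinuousLinearMap.inr ℝ (Rn n) (Rn n))) ξ
        refine h1.trans ?_
        have h2 : ∑ j, ‖(fderiv ℝ a ((x, 0) + t • (0, ξ))).comp
            (ContinuousLinearMap.inr ℝ (Rn n) (Rn n)) (EuclideanSpace.single j 1)‖ ≤
            ∑ j, C j * bracket x ^ p * (1 + (t * ‖ξ‖) ^ 2)⁻¹ := by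
          refine Finset.sum_le_sum fun j _ => ?_
          have := hC j x (t • ξ)
          simp only [List.length_nil, Nat.cast_zero, sub_zero, bracket_rpow_neg_two] at this
          simpa [mixedDeriv, partialXi, dirDeriv] using this
        refine (mul_le_mul_of_nonneg_right h2 (norm_nonneg ξ)).trans_eq ?_
        rw [← Finset.sum_mul, ← Finset.sum_mul, div_eq_mul_inv]
        ring
  refine ⟨(∑ j, C j) * π, by positivity, fun x ξ ξ' => ?_⟩
  calc ‖a (x, ξ) - a (x, ξ')‖ = ‖(a (x, ξ) - a (x, 0)) - (a (x, ξ') - a (x, 0))‖ := by congr 1; ring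
    _ ≤ _ := norm_sub_le _ _
    _ ≤ _ := add_le_add (key x ξ) (key x ξ')
    _ = _ := by ring

theorem exists_tendsto_bracket_atTop [NeZero n] :
    ∃ w : ℕ → Rn n, Tendsto (fun k => bracket (w k)) atTop atTop := by
  refine ⟨fun k => (k : ℝ) • EuclideanSpace.single 0 1, ?_⟩
  refine tendsto_atTop_mono (fun k => ?_) tendsto_natCast_atTop_atTop
  refine le_trans ?_ (norm_le_bracket _)
  simp [norm_smul]

/-- A smooth function on phase space whose first derivatives are rapidly decreasing has a limit
at infinity, which it approaches rapidly. -/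
theorem exists_limit_of_partials [NeZero n] {a : Rn n × Rn n → ℂ} (ha : ContDiff ℝ ∞ a)
    (hX : ∀ j d, IsSymbol d (partialX j a)) (hXi : ∀ j d, IsSymbol d (partialXi j a)) :
    ∃ c : ℂ, ∀ p : ℝ, p < 0 → ∃ D : ℝ, 0 ≤ D ∧ ∀ x ξ : Rn n,
      ‖a (x, ξ) - c‖ ≤ D * bracket x ^ p ∧ ‖a (x, ξ) - c‖ ≤ D * bracket ξ ^ p := by
  obtain ⟨w, hw⟩ := exists_tendsto_bracket_atTop (n := n)
  have hdecay : ∀ p : ℝ, p < 0 → Tendsto (fun k => bracket (w k) ^ p) atTop (𝓝 0) := fun p hp => by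
    have := (tendsto_rpow_neg_atTop (neg_pos.2 hp)).comp hw
    simpa [Function.comp_def] using this
  -- Two-leg paths: through the corner (x, ξ') for the first estimate, through (x', ξ) for the
  -- second. Each leg costs a power of the variable held fixed.
  have hosc : ∀ p : ℝ, ∃ D : ℝ, 0 ≤ D ∧ ∀ x ξ x' ξ' : Rn n,
      ‖a (x, ξ) - a (x', ξ')‖ ≤ D * bracket x ^ p + D * bracket ξ' ^ p ∧
      ‖a (x, ξ) - a (x', ξ')‖ ≤ D * bracket ξ ^ p + D * bracket x' ^ p := fun p => by
    obtain ⟨C, hC0, hC⟩ := exists_oscillation_x_bound ha hX p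
    obtain ⟨C', hC0', hC'⟩ := exists_oscillation_xi_bound ha hXi p
    have hp : ∀ x : Rn n, 0 ≤ bracket x ^ p := fun x => Real.rpow_nonneg (bracket_pos x).le p
    refine ⟨max C C', le_max_of_le_left hC0, fun x ξ x' ξ' => ⟨?_, ?_⟩⟩
    · refine (norm_sub_le_norm_sub_add_norm_sub _ (a (x, ξ')) _).trans (add_le_add ?_ ?_)
      · exact (hC' x ξ ξ').trans (mul_le_mul_of_nonneg_right (le_max_right _ _) (hp _))
      · exact (hC x x' ξ').trans (mul_le_mul_of_nonneg_right (le_max_left _ _) (hp _))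
    · refine (norm_sub_le_norm_sub_add_norm_sub _ (a (x', ξ)) _).trans (add_le_add ?_ ?_)
      · exact (hC x x' ξ).trans (mul_le_mul_of_nonneg_right (le_max_left _ _) (hp _))
      · exact (hC' x' ξ ξ').trans (mul_le_mul_of_nonneg_right (le_max_right _ _) (hp _))
  have hcauchy : CauchySeq fun k => a (w k, w k) := by
    obtain ⟨D, hD0, hD⟩ := hosc (-1)
    have h0 : Tendsto (fun k => D * bracket (w k) ^ (-1 : ℝ)) atTop (𝓝 0) := by
      simpa using (hdecay (-1) (by norm_num)).const_mul D
    refine Metric.cauchySeq_iff.2 fun ε hε => ?_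
    obtain ⟨N, hN⟩ := eventually_atTop.1 (h0.eventually (gt_mem_nhds (half_pos hε)))
    refine ⟨N, fun k hk l hl => ?_⟩
    rw [dist_eq_norm]
    linarith [(hD (w k) (w k) (w l) (w l)).1, hN k hk, hN l hl]
  obtain ⟨c, hc⟩ := cauchySeq_tendsto_of_complete hcauchy
  refine ⟨c, fun p hp => ?_⟩
  obtain ⟨D, hD0, hD⟩ := hosc p
  refine ⟨D, hD0, fun x ξ => ?_⟩
  -- Sending the second point to infinity in both variables removes its term, since p < 0.
  have h1 : Tendsto (fun k => ‖a (x, ξ) - a (w k, w k)‖) atTop (𝓝 ‖a (x, ξ) - c‖) :=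
    (hc.const_sub _).norm
  have h2 := fun y : Rn n => ((hdecay p hp).const_mul D).const_add (D * bracket y ^ p)
  simp only [mul_zero, add_zero] at h2
  exact ⟨le_of_tendsto_of_tendsto' h1 (h2 x) fun k => (hD x ξ (w k) (w k)).1,
    le_of_tendsto_of_tendsto' h1 (h2 ξ) fun k => (hD x ξ (w k) (w k)).2⟩

theorem exists_const_sub_isSymbol [NeZero n] {a : Rn n × Rn n → ℂ} (ha : ContDiff ℝ ∞ a)
    (hX : ∀ j d, IsSymbol d (partialX j a)) (hXi : ∀ j d, IsSymbol d (partialXi j a)) :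
    ∃ c : ℂ, ∀ m : ℝ × ℝ, IsSymbol m (fun z => a z - c) := by
  obtain ⟨c, hc⟩ := exists_limit_of_partials ha hX hXi
  refine ⟨c, fun m => ⟨ha.sub contDiff_const, fun I J => ?_⟩⟩
  rcases List.eq_nil_or_concat' J with rfl | ⟨J, j, rfl⟩
  · rcases List.eq_nil_or_concat' I with rfl | ⟨I, i, rfl⟩
    · set p := min (min m.1 m.2) (-1) with hp
      have hp1 : p ≤ m.1 := (min_le_left _ _).trans (min_le_left _ _)
      have hp2 : p ≤ m.2 := (min_le_left _ _).trans (min_le_right _ _)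
      have hp0 : p < 0 := (min_le_right _ _).trans_lt (by norm_num)
      -- The exponent is doubled because the geometric mean of the separate bounds in x and ξ halves
      -- it, yielding the product of p-th powers.
      obtain ⟨D, hD0, hD⟩ := hc (2 * p) (by linarith)
      refine ⟨D, fun x ξ => ?_⟩
      simp only [mixedDeriv, List.foldr_nil, List.length_nil, Nat.cast_zero, sub_zero]
      have e : ∀ y : Rn n, bracket y ^ (2 * p) = (bracket y ^ p) ^ 2 := fun y => by
        rw [← Real.rpow_natCast, ← Real.rpow_mul (bracket_pos y).le, mul_comm]; norm_num
      have hxp := Real.rpow_nonneg (bracket_pos x).le p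
      have hξp := Real.rpow_nonneg (bracket_pos ξ).le p
      have h := hD x ξ
      rw [e, e] at h
      have h2 : ‖a (x, ξ) - c‖ ≤ D * bracket x ^ p * bracket ξ ^ p := by
        refine (sq_le_sq₀ (norm_nonneg _) (by positivity)).1 ?_
        calc ‖a (x, ξ) - c‖ ^ 2 = ‖a (x, ξ) - c‖ * ‖a (x, ξ) - c‖ := sq _
          _ ≤ (D * (bracket x ^ p) ^ 2) * (D * (bracket ξ ^ p) ^ 2) :=
            mul_le_mul h.1 h.2 (norm_nonneg _) (by positivity)
          _ = _ := by ring
      refine h2.trans ?_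
      have := bracket_pos x
      gcongr
      · exact one_le_bracket x
      · exact one_le_bracket ξ
    · have : partialX i (fun z => a z - c) = partialX i a := by
        ext z; simp only [partialX, dirDeriv, fderiv_sub_const]
      rw [mixedDeriv_append_x, this]
      -- Lowering the order by one accounts for the derivative removed from the list.
      simpa [sub_sub, add_comm] using (hX i (m.1 - 1, m.2)).bound I []
  · have : partialXi j (fun z => a z - c) = partialXi j a := by
      ext z; simp only [partialXi, dirDeriv, fderiv_sub_const]
    rw [mixedDeriv_append_xi, this]
    simpa [sub_sub, add_comm] using (hXi j (m.1, m.2 - 1)).bound I J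

end Constant

/-! ### L¹ bounds for residual operators and their failure for the identity -/

section Residual

theorem integrable_bracket_rpow {p : ℝ} (hp : p < -n) :
    Integrable (fun x : Rn n => bracket x ^ p) := by
  have h := integrable_rpow_neg_one_add_norm_sq (μ := (volume : Measure (Rn n))) (r := -p)
    (by rw [finrank_euclideanSpace_fin]; linarith)
  refine h.congr (.of_forall fun x => ?_)
  simp only [bracket]
  rw [Real.sqrt_eq_rpow, ← Real.rpow_mul (by positivity)]
  congr 1; ring

/-- The order -(n+1) in each variable makes the symbol integrable in ξ and the result integrable in
x. The L¹ bound is there so that two residual operators can be composed. -/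
theorem exists_L1_bound_of_mem_RG {R : Module.End ℂ 𝓢(Rn n, ℂ)} (hR : R ∈ RG n) :
    ∃ C : ℝ, 0 ≤ C ∧ ∀ u : 𝓢(Rn n, ℂ),
      (∀ x, ‖R u x‖ ≤ C * ∫ y, ‖u y‖) ∧ ∫ x, ‖R u x‖ ≤ C * ∫ y, ‖u y‖ := by
  obtain ⟨r, hr, hop⟩ := hR
  set p : ℝ := -(n + 1) with hp
  have hi : Integrable (fun x : Rn n => bracket x ^ p) := integrable_bracket_rpow (by linarith)
  obtain ⟨C, hC0, hC⟩ := exists_nonneg_bound (hr (p, p)) [] []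
  simp only [mixedDeriv, List.foldr_nil, List.length_nil, Nat.cast_zero, sub_zero] at hC
  set M := ∫ ξ : Rn n, bracket ξ ^ p
  have hb : ∀ x : Rn n, 0 ≤ bracket x ^ p := fun x => Real.rpow_nonneg (bracket_pos x).le p
  have hM : 0 ≤ M := integral_nonneg hb
  set K : ℝ := ‖((2 * π : ℝ) : ℂ)⁻¹ ^ n‖
  have key : ∀ (u : 𝓢(Rn n, ℂ)) x, ‖R u x‖ ≤ K * C * M * (∫ y, ‖u y‖) * bracket x ^ p :=
    fun u x => by
      rw [hop, opApply, norm_mul]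
      have h1 : ∀ ξ : Rn n, ‖∫ y : Rn n, Complex.exp (Complex.I * ((inner ℝ (x - y) ξ : ℝ) : ℂ)) *
          r (x, ξ) * u y‖ ≤ C * bracket x ^ p * (∫ y, ‖u y‖) * bracket ξ ^ p := fun ξ => by
        calc _ ≤ ∫ y, C * bracket x ^ p * bracket ξ ^ p * ‖u y‖ := by
              refine norm_integral_le_of_norm_le (u.integrable.norm.const_mul _)
                (.of_forall fun y => ?_)
              rw [norm_mul, norm_mul, mul_comm Complex.I, Complex.norm_exp_ofReal_mul_I, one_mul]
              exact mul_le_mul_of_nonneg_right (hC x ξ) (norm_nonneg _)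
          _ = _ := by rw [integral_const_mul]; ring
      have h2 := norm_integral_le_of_norm_le (hi.const_mul _) (.of_forall h1)
      rw [integral_const_mul] at h2
      calc _ ≤ K * (C * bracket x ^ p * (∫ y, ‖u y‖) * M) :=
            mul_le_mul_of_nonneg_left h2 (norm_nonneg _)
        _ = _ := by ring
  have hK : 0 ≤ K := norm_nonneg _
  -- In 1 + M the 1 serves the pointwise bound and the M the integral bound.
  refine ⟨K * C * M * (1 + M), by positivity, fun u => ?_⟩
  have hu : 0 ≤ ∫ y, ‖u y‖ := integral_nonneg fun y => norm_nonneg _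
  refine ⟨fun x => (key u x).trans ?_, ?_⟩
  · have : bracket x ^ p ≤ 1 + M :=
      (Real.rpow_le_one_of_one_le_of_nonpos (one_le_bracket x) (by rw [hp]; linarith)).trans
        (by linarith)
    calc _ ≤ K * C * M * (∫ y, ‖u y‖) * (1 + M) := by gcongr
      _ = _ := by ring
  · calc ∫ x, ‖R u x‖ ≤ ∫ x, K * C * M * (∫ y, ‖u y‖) * bracket x ^ p :=
          integral_mono (R u).integrable.norm (hi.const_mul _) (key u)
      _ = K * C * M * (∫ y, ‖u y‖) * M := integral_const_mul _ _
      _ ≤ K * C * M * (∫ y, ‖u y‖) * (1 + M) := by gcongr; linarith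
      _ = _ := by ring

/-- Replacing a bump u by u(kx) keeps the value 1 at the origin and divides the L¹ norm by kⁿ ≥ k,
which uses n ≥ 1. -/
theorem not_eval_zero_le_L1 [NeZero n] (C : ℝ) :
    ¬ ∀ u : 𝓢(Rn n, ℂ), ‖u 0‖ ≤ C * ∫ y, ‖u y‖ := by
  intro h
  let f : ContDiffBump (0 : Rn n) := default
  have hf₁ : HasCompactSupport (Complex.ofRealCLM ∘ f) := f.hasCompactSupport.comp_left rfl
  have hf₂ : ContDiff ℝ ∞ (Complex.ofRealCLM ∘ f) := Complex.ofRealCLM.contDiff.comp f.contDiff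
  let u := hf₁.toSchwartzMap hf₂
  have hu : u 0 = 1 := by
    have : f 0 = 1 := f.eventuallyEq_one.eq_of_nhds
    simp [u, this]
  obtain ⟨k, hk⟩ := exists_nat_gt (max 1 (C * ∫ y, ‖u y‖))
  have hk1 : (1 : ℝ) < k := (le_max_left _ _).trans_lt hk
  have hk2 : C * ∫ y, ‖u y‖ < k := (le_max_right _ _).trans_lt hk
  have hk0 : (k : ℝ) ≠ 0 := by positivity
  let g : Rn n ≃L[ℝ] Rn n := ContinuousLinearEquiv.smulLeft (Units.mk0 (k : ℝ) hk0)
  have h1 := h (SchwartzMap.compCLMOfContinuousLinearEquiv ℂ g u)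
  have hg : ∀ x, g x = (k : ℝ) • x := fun x => rfl
  simp only [SchwartzMap.compCLMOfContinuousLinearEquiv_apply, Function.comp_apply, hg,
    smul_zero, hu, norm_one] at h1
  rw [Measure.integral_comp_smul volume (fun y => ‖u y‖), finrank_euclideanSpace_fin,
    abs_of_pos (by positivity), smul_eq_mul, mul_left_comm, inv_mul_eq_div,
    le_div_iff₀ (by positivity), one_mul] at h1
  have : (k : ℝ) ≤ k ^ n := le_self_pow₀ hk1.le (NeZero.ne n)
  linarith

end Residual

/-! ### Assembly, and nonvanishing of the constant -/

section Main

theorem sub_const_mem_RG {m : ℝ × ℝ} {a : Rn n × Rn n → ℂ} {A : Module.End ℂ 𝓢(Rn n, ℂ)} {c : ℂ}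
    (ha : IsSymbol m a) (hA : IsOp a A) (h : ∀ d : ℝ × ℝ, IsSymbol d (fun z => a z - c)) :
    A - c • (1 : Module.End ℂ 𝓢(Rn n, ℂ)) ∈ RG n := by
  refine ⟨_, h, fun u x => ?_⟩
  have hc : ModerateGrowth (fun _ : Rn n × Rn n => c) :=
    ⟨continuous_const, ‖c‖, 0, norm_nonneg _, by simp⟩
  have h1 := opApply_mul_left (fun _ => 1) (fun _ => c) u x
  simp only [mul_one] at h1
  rw [opApply_sub ha.moderateGrowth hc, h1, opApply_one, ← hA u x]
  rfl

theorem exists_sub_const_mem_RG [NeZero n] {A : Module.End ℂ 𝓢(Rn n, ℂ)} (hA : A ∈ SGPsiDO n)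
    (hcomm : ∀ P ∈ LG n, A * P - P * A ∈ RG n) :
    ∃ c : ℂ, A - c • (1 : Module.End ℂ 𝓢(Rn n, ℂ)) ∈ RG n := by
  obtain ⟨m, a, ha, hop⟩ := hA
  obtain ⟨c, hc⟩ := exists_const_sub_isSymbol ha.smooth
    (fun j => isSymbol_partialX_of_commutator ha hop (hcomm _ (momentum_mem_LG j)))
    (fun j => isSymbol_partialXi_of_commutator ha hop (hcomm _ (mulCoord_mem_LG j)))
  exact ⟨c, sub_const_mem_RG ha hop hc⟩

/-- Phase space is a point and the bracket equals 1 there, so the weights are all 1. -/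
theorem isSymbol_of_dim_zero (m : ℝ × ℝ) (a : Rn 0 × Rn 0 → ℂ) : IsSymbol m a where
  smooth := by
    have : a = fun _ => a 0 := funext fun z => congrArg a (Subsingleton.elim z 0)
    rw [this]
    exact contDiff_const
  bound I J := by
    refine ⟨‖mixedDeriv I J a (0, 0)‖, fun x ξ => ?_⟩
    obtain rfl := Subsingleton.elim x 0
    obtain rfl := Subsingleton.elim ξ 0
    simp [bracket]

/-- If `A` is residual, it has no parametrix of the form scalar plus residual. -/
theorem not_mul_sub_one_mem_RG [NeZero n] {A B : Module.End ℂ 𝓢(Rn n, ℂ)} {c : ℂ} (hA : A ∈ RG n)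
    (hB : B - c • (1 : Module.End ℂ 𝓢(Rn n, ℂ)) ∈ RG n) : A * B - 1 ∉ RG n := by
  intro h
  obtain ⟨C₁, h₁, hC₁⟩ := exists_L1_bound_of_mem_RG hA
  obtain ⟨C₂, h₂, hC₂⟩ := exists_L1_bound_of_mem_RG hB
  obtain ⟨C₃, h₃, hC₃⟩ := exists_L1_bound_of_mem_RG h
  refine not_eval_zero_le_L1 (n := n) (C₁ * C₂ + ‖c‖ * C₁ + C₃) fun u => ?_
  set v := (B - c • (1 : Module.End ℂ 𝓢(Rn n, ℂ))) u with hv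
  -- I = A(B - c) + cA - (AB - 1), evaluated at the origin; each term on the right is L¹-bounded.
  have e : u 0 = A v 0 + c * A u 0 - (A * B - 1) u 0 := by
    have : B u = v + c • u := by simp [hv]
    simp [this]
  calc ‖u 0‖ ≤ ‖A v 0‖ + ‖c‖ * ‖A u 0‖ + ‖(A * B - 1) u 0‖ := by
        rw [e, ← norm_mul]
        exact (norm_sub_le _ _).trans (add_le_add_left (norm_add_le _ _) _)
    _ ≤ C₁ * (C₂ * ∫ y, ‖u y‖) + ‖c‖ * (C₁ * ∫ y, ‖u y‖) + C₃ * ∫ y, ‖u y‖ := by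
        gcongr
        · exact ((hC₁ v).1 0).trans (mul_le_mul_of_nonneg_left (hC₂ u).2 h₁)
        · exact (hC₁ u).1 0
        · exact (hC₃ u).1 0
    _ = _ := by ring

end Main

end SGCalc

theorem mainTheorem10 (n : ℕ) (E E' : Module.End ℂ 𝓢(SGCalc.Rn n, ℂ))
    (hE : E ∈ SGCalc.SGPsiDO n) (hE' : E' ∈ SGCalc.SGPsiDO n)
    (hpar : SGCalc.AreParametrices E E')
    (hcomm : ∀ P ∈ SGCalc.LG n, E * P - P * E ∈ SGCalc.RG n)
    (hcomm' : ∀ P ∈ SGCalc.LG n, E' * P - P * E' ∈ SGCalc.RG n) :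
    ∃ c : ℂ, c ≠ 0 ∧ ∃ R ∈ SGCalc.RG n, E = c • (1 : Module.End ℂ 𝓢(SGCalc.Rn n, ℂ)) + R := by
  rcases eq_or_ne n 0 with rfl | hn
  · obtain ⟨m, a, ha, hop⟩ := hE
    -- In dimension zero E - c is residual for every c, so 1 is an arbitrary nonzero choice.
    exact ⟨1, one_ne_zero, _, SGCalc.sub_const_mem_RG ha hop
      fun d => SGCalc.isSymbol_of_dim_zero d _, (add_sub_cancel _ _).symm⟩
  · have : NeZero n := ⟨hn⟩
    obtain ⟨c, hc⟩ := SGCalc.exists_sub_const_mem_RG hE hcomm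
    obtain ⟨c', hc'⟩ := SGCalc.exists_sub_const_mem_RG hE' hcomm'
    refine ⟨c, ?_, _, hc, (add_sub_cancel _ _).symm⟩
    rintro rfl
    rw [zero_smul, sub_zero] at hc
    exact SGCalc.not_mul_sub_one_mem_RG hc hc' hpar.1
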